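/- Let $R$ be a commutative Noetherian ring and let $Z\subseteq\operatorname{Spec}R$ be stable under specialization (if $\mathfrak p\subseteq\mathfrak q$ are primes and $\mathfrak p\in Z$, then $\mathfrak q\in Z$). Let $\mathcal T_Z$ be the class of $R$-modules $T$ with $\operatorname{Supp}(T)\subseteq Z$, let $R\text{-Mod}/\mathcal T_Z$ be the quotient category (the localization of $R\text{-Mod}$ at the morphisms whose kernel and cokernel lie in $\mathcal T_Z$), and let $t(R)$ be the largest ideal of $R$ that belongs to $\mathcal T_Z$ as an $R$-module. Let $$R_Z=\varinjlim_{\mathfrak a}\operatorname{Hom}_R(\mathfrak a,R/t(R)),$$ where $\mathfrak a$ runs through the ideals of $R$ with $R/\mathfrak a\in\mathcal T_Z$, ordered by reverse inclusion, with its canonical commutative ring structure, in which the product of the classes of $f:\mathfrak a\to R/t(R)$ and $g:\mathfrak b\to R/t(R)$ is the class of the map $\mathfrak a\mathfrak b\to R/t(R)$ with $xy\mapsto f(x)g(y)$. Let $\mu:R\to R_Z$ be the ring homomorphism that sends $r$ to the class of the map $R\to R/t(R)$, $x\mapsto xr+t(R)$. Then the following assertions are equivalent: 1. $R\text{-Mod}/\mathcal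 T_Z$ is a module category, i.e. it is equivalent to the category of all modules over some associative unital ring, not necessarily commutative. 2. $Z$ is perfect, i.e. $R_Z$ is flat as an $R$-module and $Z$ is the set of all prime ideals $\mathfrak p$ of $R$ with $\mu(\mathfrak p)R_Z=R_Z$. -/

import Mathlib

open CategoryTheory

universe u

noncomputable section

namespace SpecLocalization

/-- A category is a module category if it is equivalent to the category of all (small) modules
over some associative unital ring, not necessarily commutative. -/
def IsModuleCategory.{t, w, v} (C : Type v) [Category.{w} C] : Prop :=
  ∃ (A : Type t) (_ : Ring A), Nonempty (C ≌ ModuleCat.{t} A)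

section TorsionClass

variable {R : Type u} [CommRing R] (Z : Set (PrimeSpectrum R))

/-- The class `𝒯_Z` of the `R`-modules whose support is contained in `Z`. -/
def torsionClass : ObjectProperty (ModuleCat.{u} R) :=
  fun M => Module.support R M ⊆ Z

instance : (torsionClass Z).IsSerreClass where
  exists_zero := ⟨ModuleCat.of R PUnit, ModuleCat.isZero_of_subsingleton _, by
    simp [torsionClass, Module.support_eq_empty]⟩
  prop_of_mono f _ h :=
    (Module.support_subset_of_injective f.hom ((ModuleCat.mono_iff_injective f).1 ‹_›)).trans h
  prop_of_epi f _ h :=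
    (Module.support_subset_of_surjective f.hom ((ModuleCat.epi_iff_surjective f).1 ‹_›)).trans h
  prop_X₂_of_shortExact {S} hS h₁ h₃ := by
    have := Module.support_of_exact (f := S.f.hom) (g := S.g.hom)
      ((ShortComplex.ShortExact.moduleCat_exact_iff_function_exact S).1 hS.exact)
      hS.moduleCat_injective_f hS.moduleCat_surjective_g
    simpa [torsionClass, this] using And.intro h₁ h₃

/-- The quotient category `R-Mod / 𝒯_Z`: the localization of `R-Mod` at the morphisms whose kernel
and cokernel are in `𝒯_Z`. -/
abbrev QuotientCategory : Type (u + 1) :=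
  (torsionClass Z).isoModSerre.Localization

/-- The torsion radical `Γ_Z(M)`: the largest submodule of `M` that lies in `𝒯_Z`. -/
def torsionRadical (M : Type u) [AddCommGroup M] [Module R M] : Submodule R M :=
  sSup {N : Submodule R M | torsionClass Z (ModuleCat.of R N)}

/-- The torsion radical of `R` itself, as an ideal. -/
abbrev torsionIdeal : Ideal R := torsionRadical Z R

variable {Z}

theorem exists_smul_eq_zero_of_mem_torsionRadical {M : Type u} [AddCommGroup M] [Module R M]
    {m : M} (hm : m ∈ torsionRadical Z M) {p : PrimeSpectrum R} (hp : p ∉ Z) :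
    ∃ r ∉ p.asIdeal, r • m = 0 := by
  rw [torsionRadical, sSup_eq_iSup'] at hm
  induction hm using Submodule.iSup_induction' with
  | mem N x hx =>
    obtain ⟨r, hr, h⟩ := Module.notMem_support_iff'.1 (fun h => hp (N.2 h)) (⟨x, hx⟩ : N.1)
    exact ⟨r, hr, congrArg Subtype.val h⟩
  | zero => exact ⟨1, p.asIdeal.primeCompl.one_mem, smul_zero _⟩
  | add x y _ _ hx hy =>
    obtain ⟨r, hr, hrx⟩ := hx
    obtain ⟨s, hs, hsy⟩ := hy
    refine ⟨r * s, p.asIdeal.primeCompl.mul_mem hr hs, ?_⟩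
    rw [smul_add, mul_smul r s y, hsy, mul_comm, mul_smul, hrx, smul_zero, smul_zero, add_zero]

theorem mem_torsionRadical_iff {M : Type u} [AddCommGroup M] [Module R M] {m : M} :
    m ∈ torsionRadical Z M ↔ ∀ p ∉ Z, ∃ r ∉ p.asIdeal, r • m = 0 := by
  refine ⟨fun hm p hp => exists_smul_eq_zero_of_mem_torsionRadical hm hp, fun h => ?_⟩
  refine (le_sSup (a := Submodule.span R {m}) ?_) (Submodule.mem_span_singleton_self m)
  intro p hp
  by_contra hpZ
  obtain ⟨r, hr, hrm⟩ := h p hpZ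
  refine Module.notMem_support_iff'.2 (fun x => ⟨r, hr, ?_⟩) hp
  obtain ⟨x, hx⟩ := x
  obtain ⟨a, rfl⟩ := Submodule.mem_span_singleton.1 hx
  exact Subtype.ext (by simp [smul_comm r a, hrm])

end TorsionClass

section RingOfFractions

variable {R : Type u} [CommRing R] (Z : Set (PrimeSpectrum R))

/-- The Gabriel topology of `𝒯_Z`: the ideals `a` of `R` such that `R / a` is in `𝒯_Z`. -/
def gabrielTopology : Set (Ideal R) :=
  {a | torsionClass Z (ModuleCat.of R (R ⧸ a))}

variable {Z}

theorem mem_gabrielTopology_iff {a : Ideal R} :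
    a ∈ gabrielTopology Z ↔ PrimeSpectrum.zeroLocus (a : Set R) ⊆ Z := by
  change Module.support R (R ⧸ a) ⊆ Z ↔ _
  rw [Module.support_eq_zeroLocus, Ideal.annihilator_quotient]

theorem top_mem_gabrielTopology : (⊤ : Ideal R) ∈ gabrielTopology Z := by
  simp [mem_gabrielTopology_iff]

theorem mul_mem_gabrielTopology {a b : Ideal R} (ha : a ∈ gabrielTopology Z)
    (hb : b ∈ gabrielTopology Z) : a * b ∈ gabrielTopology Z := by
  rw [mem_gabrielTopology_iff] at *
  simpa [PrimeSpectrum.zeroLocus_mul] using And.intro ha hb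

theorem eq_zero_of_smul_eq_zero {a : Ideal R} (ha : a ∈ gabrielTopology Z)
    {s : R ⧸ torsionIdeal Z} (h : ∀ x ∈ a, x • s = 0) : s = 0 := by
  obtain ⟨r, rfl⟩ := Ideal.Quotient.mk_surjective s
  refine Ideal.Quotient.eq_zero_iff_mem.2 (mem_torsionRadical_iff.2 fun p hp => ?_)
  obtain ⟨x, hxa, hxp⟩ := SetLike.not_le_iff_exists.1
    fun hap : a ≤ p.asIdeal => hp (mem_gabrielTopology_iff.1 ha hap)
  have hxr : x * r ∈ torsionIdeal Z := Ideal.Quotient.eq_zero_iff_mem.1 (h x hxa)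
  obtain ⟨y, hy, hyx⟩ := mem_torsionRadical_iff.1 hxr p hp
  exact ⟨y * x, p.asIdeal.primeCompl.mul_mem hy hxp, by simpa [mul_assoc] using hyx⟩

variable (Z)

/-- The Gabriel topology ordered by reverse inclusion, as the index set of a direct system. -/
abbrev GabrielIndex : Type u := (gabrielTopology Z)ᵒᵈ

instance : DecidableEq (GabrielIndex Z) := Classical.decEq _

instance : Nonempty (GabrielIndex Z) := ⟨OrderDual.toDual ⟨⊤, top_mem_gabrielTopology⟩⟩

variable {Z}

/-- The ideal underlying an index. -/
def GabrielIndex.ideal (i : GabrielIndex Z) : Ideal R := (OrderDual.ofDual i).1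

theorem GabrielIndex.ideal_mem (i : GabrielIndex Z) : i.ideal ∈ gabrielTopology Z :=
  (OrderDual.ofDual i).2

theorem GabrielIndex.ideal_le {i j : GabrielIndex Z} (h : i ≤ j) : j.ideal ≤ i.ideal := h

/-- The index of the unit ideal. -/
def GabrielIndex.top : GabrielIndex Z := OrderDual.toDual ⟨⊤, top_mem_gabrielTopology⟩

/-- The index of the product of two ideals. -/
def GabrielIndex.mul (i j : GabrielIndex Z) : GabrielIndex Z :=
  OrderDual.toDual ⟨i.ideal * j.ideal, mul_mem_gabrielTopology i.ideal_mem j.ideal_mem⟩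

theorem GabrielIndex.le_mul_left (i j : GabrielIndex Z) : i ≤ i.mul j :=
  show i.ideal * j.ideal ≤ i.ideal from Ideal.mul_le_left

theorem GabrielIndex.le_mul_right (i j : GabrielIndex Z) : j ≤ i.mul j :=
  show i.ideal * j.ideal ≤ j.ideal from Ideal.mul_le_right

instance : IsDirectedOrder (GabrielIndex Z) :=
  ⟨fun i j => ⟨i.mul j, i.le_mul_left j, i.le_mul_right j⟩⟩

variable (Z)

/-- The terms `Hom_R(a, R / Γ_Z(R))` of the direct system. -/
abbrev FractionHom (i : GabrielIndex Z) : Type u := i.ideal →ₗ[R] R ⧸ torsionIdeal Z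

/-- The transition maps of the direct system: restriction to a smaller ideal. -/
def FractionHom.restrict (i j : GabrielIndex Z) (h : i ≤ j) :
    FractionHom Z i →ₗ[R] FractionHom Z j :=
  LinearMap.lcomp R _ (Submodule.inclusion (GabrielIndex.ideal_le h))

/-- The ring of fractions `R_Z`, the direct limit of `Hom_R(a, R / Γ_Z(R))` where `a` runs through
the Gabriel topology of `𝒯_Z` ordered by reverse inclusion. -/
def RingOfFractions : Type u :=
  Module.DirectLimit (FractionHom Z) (FractionHom.restrict Z)

namespace RingOfFractions

instance : AddCommGroup (RingOfFractions Z) :=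
  inferInstanceAs (AddCommGroup (Module.DirectLimit (FractionHom Z) (FractionHom.restrict Z)))

instance : Module R (RingOfFractions Z) :=
  inferInstanceAs (Module R (Module.DirectLimit (FractionHom Z) (FractionHom.restrict Z)))

/-- The canonical map from a term of the direct system to the direct limit. -/
def of (i : GabrielIndex Z) : FractionHom Z i →ₗ[R] RingOfFractions Z :=
  Module.DirectLimit.of R (GabrielIndex Z) (FractionHom Z) (FractionHom.restrict Z) i

variable {Z}

theorem of_restrict {i j : GabrielIndex Z} (h : i ≤ j) (f : FractionHom Z i) :
    of Z j (FractionHom.restrict Z i j h f) = of Z i f :=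
  Module.DirectLimit.of_f

theorem exists_of (z : RingOfFractions Z) : ∃ i f, of Z i f = z :=
  Module.DirectLimit.exists_of z

/-- Given `f` defined on `a` and `g` defined on `b`, there is a linear map on `a * b` that sends
`x * y` to `f x * g y`. -/
theorem exists_mulHom (i j : GabrielIndex Z) (f : FractionHom Z i) (g : FractionHom Z j) :
    ∃ h : FractionHom Z (i.mul j), ∀ (x : i.ideal) (y : j.ideal),
      h ⟨x.1 * y.1, Ideal.mul_mem_mul x.2 y.2⟩ = f x * g y := by
  let m : TensorProduct R i.ideal j.ideal →ₗ[R] ↥(i.ideal * j.ideal) :=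
    Submodule.mulMap' i.ideal j.ideal
  have hm : Function.Surjective m := Submodule.mulMap'_surjective _ _
  let t : TensorProduct R i.ideal j.ideal →ₗ[R] R ⧸ torsionIdeal Z :=
    TensorProduct.lift ((LinearMap.mul R (R ⧸ torsionIdeal Z)).compl₁₂ f g)
  have key : ∀ (u : i.ideal) (v : j.ideal) z,
      (u.1 * v.1) • t z = (m z).1 • (f u * g v) := by
    intro u v z
    induction z with
    | zero => simp
    | add z w hz hw => simp [smul_add, add_smul, hz, hw]
    | tmul x y =>
      have hf : u.1 • f x = x.1 • f u := by
        rw [← map_smul, ← map_smul]; exact congrArg f (Subtype.ext (mul_comm _ _))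
      have hg : v.1 • g y = y.1 • g v := by
        rw [← map_smul, ← map_smul]; exact congrArg g (Subtype.ext (mul_comm _ _))
      change (u.1 * v.1) • (f x * g y) = (x.1 * y.1) • (f u * g v)
      rw [← smul_mul_smul_comm, ← smul_mul_smul_comm, hf, hg]
  have hker : LinearMap.ker m ≤ LinearMap.ker t := by
    intro z hz
    rw [LinearMap.mem_ker] at hz ⊢
    refine eq_zero_of_smul_eq_zero (i.mul j).ideal_mem fun c hc => ?_
    refine Submodule.mul_induction_on (C := fun c => c • t z = 0) hc (fun u hu v hv => ?_)
      (fun x y hx hy => by rw [add_smul, hx, hy, add_zero])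
    simpa [hz] using key ⟨u, hu⟩ ⟨v, hv⟩ z
  refine ⟨((LinearMap.ker m).liftQ t hker).comp
    (m.quotKerEquivOfSurjective hm).symm.toLinearMap, fun x y => ?_⟩
  have : (m.quotKerEquivOfSurjective hm).symm ⟨x.1 * y.1, Ideal.mul_mem_mul x.2 y.2⟩ =
      Submodule.Quotient.mk (x ⊗ₜ[R] y) := by
    rw [LinearEquiv.symm_apply_eq]; rfl
  change (LinearMap.ker m).liftQ t hker
    ((m.quotKerEquivOfSurjective hm).symm ⟨x.1 * y.1, Ideal.mul_mem_mul x.2 y.2⟩) = _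
  rw [this]
  rfl

/-- The product of `f : a → R / Γ_Z(R)` and `g : b → R / Γ_Z(R)`, defined on `a * b`. -/
def mulHom (i j : GabrielIndex Z) (f : FractionHom Z i) (g : FractionHom Z j) :
    FractionHom Z (i.mul j) := (exists_mulHom i j f g).choose

theorem mulHom_apply {i j : GabrielIndex Z} (f : FractionHom Z i) (g : FractionHom Z j)
    {x y : R} (hx : x ∈ i.ideal) (hy : y ∈ j.ideal) :
    mulHom i j f g ⟨x * y, Ideal.mul_mem_mul hx hy⟩ = f ⟨x, hx⟩ * g ⟨y, hy⟩ :=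
  (exists_mulHom i j f g).choose_spec ⟨x, hx⟩ ⟨y, hy⟩

theorem hom_ext_mul {i j : GabrielIndex Z} {h h' : FractionHom Z (i.mul j)}
    (H : ∀ (x y : R) (hx : x ∈ i.ideal) (hy : y ∈ j.ideal),
      h ⟨x * y, Ideal.mul_mem_mul hx hy⟩ = h' ⟨x * y, Ideal.mul_mem_mul hx hy⟩) : h = h' := by
  ext ⟨z, hz⟩
  refine Submodule.mul_induction_on' (C := fun z hz => h ⟨z, hz⟩ = h' ⟨z, hz⟩)
    (fun x hx y hy => H x y hx hy) (fun x hx y hy e₁ e₂ => ?_) hz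
  exact (map_add h ⟨x, hx⟩ ⟨y, hy⟩).trans
    ((congrArg₂ (· + ·) e₁ e₂).trans (map_add h' ⟨x, hx⟩ ⟨y, hy⟩).symm)

/-- The universal property of the direct limit. -/
def lift {P : Type u} [AddCommGroup P] [Module R P] (φ : ∀ i, FractionHom Z i →ₗ[R] P)
    (hφ : ∀ i j h f, φ j (FractionHom.restrict Z i j h f) = φ i f) : RingOfFractions Z →ₗ[R] P :=
  Module.DirectLimit.lift R (GabrielIndex Z) (FractionHom Z) (FractionHom.restrict Z) φ hφ

theorem lift_of {P : Type u} [AddCommGroup P] [Module R P] (φ : ∀ i, FractionHom Z i →ₗ[R] P)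
    (hφ : ∀ i j h f, φ j (FractionHom.restrict Z i j h f) = φ i f) (i : GabrielIndex Z)
    (f : FractionHom Z i) : lift φ hφ (of Z i f) = φ i f :=
  Module.DirectLimit.lift_of φ hφ f

/-- The bilinear map that sends `f` and `g` to the class of their product. -/
def mulHomMap (i j : GabrielIndex Z) :
    FractionHom Z i →ₗ[R] FractionHom Z j →ₗ[R] RingOfFractions Z :=
  LinearMap.mk₂ R (fun f g => of Z (i.mul j) (mulHom i j f g))
    (fun f f' g => by
      rw [← map_add]; congr 1
      refine hom_ext_mul fun x y hx hy => ?_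
      simp [mulHom_apply, hx, hy, add_mul])
    (fun c f g => by
      rw [← map_smul]; congr 1
      refine hom_ext_mul fun x y hx hy => ?_
      simp [mulHom_apply, hx, hy])
    (fun f g g' => by
      rw [← map_add]; congr 1
      refine hom_ext_mul fun x y hx hy => ?_
      simp [mulHom_apply, hx, hy, mul_add])
    (fun c f g => by
      rw [← map_smul]; congr 1
      refine hom_ext_mul fun x y hx hy => ?_
      simp [mulHom_apply, hx, hy])

theorem mulHomMap_restrict_right (i : GabrielIndex Z) {j k : GabrielIndex Z} (hjk : j ≤ k)
    (f : FractionHom Z i) (g : FractionHom Z j) :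
    mulHomMap i k f (FractionHom.restrict Z j k hjk g) = mulHomMap i j f g := by
  have hle : i.mul j ≤ i.mul k := Ideal.mul_mono_right (GabrielIndex.ideal_le hjk)
  change of Z (i.mul k) (mulHom i k f (FractionHom.restrict Z j k hjk g)) =
    of Z (i.mul j) (mulHom i j f g)
  rw [← of_restrict hle]
  congr 1
  refine hom_ext_mul fun x y hx hy => ?_
  rw [mulHom_apply _ _ hx hy]
  exact (mulHom_apply f g hx (GabrielIndex.ideal_le hjk hy)).symm

theorem mulHomMap_restrict_left {i k : GabrielIndex Z} (j : GabrielIndex Z) (hik : i ≤ k)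
    (f : FractionHom Z i) (g : FractionHom Z j) :
    mulHomMap k j (FractionHom.restrict Z i k hik f) g = mulHomMap i j f g := by
  have hle : i.mul j ≤ k.mul j := Ideal.mul_mono_left (GabrielIndex.ideal_le hik)
  change of Z (k.mul j) (mulHom k j (FractionHom.restrict Z i k hik f) g) =
    of Z (i.mul j) (mulHom i j f g)
  rw [← of_restrict hle]
  congr 1
  refine hom_ext_mul fun x y hx hy => ?_
  rw [mulHom_apply _ _ hx hy]
  exact (mulHom_apply f g (GabrielIndex.ideal_le hik hx) hy).symm

variable (Z) in
/-- The multiplication of `R_Z`, as a bilinear map. -/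
def mulMap : RingOfFractions Z →ₗ[R] RingOfFractions Z →ₗ[R] RingOfFractions Z :=
  lift
    (fun i => (lift (fun j => (mulHomMap i j).flip) fun _ _ hjk g =>
      LinearMap.ext fun f => mulHomMap_restrict_right i hjk f g).flip)
    (fun i k hik f => by
      refine LinearMap.ext fun z => ?_
      obtain ⟨j, g, rfl⟩ := exists_of z
      rw [LinearMap.flip_apply, LinearMap.flip_apply, lift_of, lift_of]
      exact mulHomMap_restrict_left j hik f g)

instance : Mul (RingOfFractions Z) := ⟨fun x y => mulMap Z x y⟩

instance : One (RingOfFractions Z) :=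
  ⟨of Z GabrielIndex.top ((torsionIdeal Z).mkQ.comp (Submodule.subtype ⊤))⟩

theorem of_mul_of (i j : GabrielIndex Z) (f : FractionHom Z i) (g : FractionHom Z j) :
    of Z i f * of Z j g = of Z (i.mul j) (mulHom i j f g) := by
  change mulMap Z (of Z i f) (of Z j g) = _
  rw [mulMap, lift_of, LinearMap.flip_apply, lift_of]
  rfl

protected theorem mul_comm' (x y : RingOfFractions Z) : x * y = y * x := by
  obtain ⟨i, f, rfl⟩ := exists_of x
  obtain ⟨j, g, rfl⟩ := exists_of y
  have hle : j.mul i ≤ i.mul j := (mul_comm i.ideal j.ideal).le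
  rw [of_mul_of, of_mul_of, ← of_restrict hle]
  congr 1
  refine hom_ext_mul fun x y hx hy => ?_
  rw [mulHom_apply _ _ hx hy, mul_comm, ← mulHom_apply _ _ hy hx]
  exact congrArg (mulHom j i g f) (Subtype.ext (mul_comm y x))

protected theorem mul_assoc' (x y z : RingOfFractions Z) : x * y * z = x * (y * z) := by
  obtain ⟨i, f, rfl⟩ := exists_of x
  obtain ⟨j, g, rfl⟩ := exists_of y
  obtain ⟨k, h, rfl⟩ := exists_of z
  have hle : i.mul (j.mul k) ≤ (i.mul j).mul k := (mul_assoc i.ideal j.ideal k.ideal).le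
  simp only [of_mul_of]
  rw [← of_restrict hle]
  congr 1
  refine hom_ext_mul fun w c hw hc => ?_
  refine Submodule.mul_induction_on' (C := fun w hw =>
    mulHom (i.mul j) k (mulHom i j f g) h ⟨w * c, Ideal.mul_mem_mul hw hc⟩ =
      FractionHom.restrict Z _ _ hle (mulHom i (j.mul k) f (mulHom j k g h))
        ⟨w * c, Ideal.mul_mem_mul hw hc⟩) (fun a ha b hb => ?_) (fun a ha b hb e₁ e₂ => ?_) hw
  · have h₁ := mulHom_apply (mulHom i j f g) h (Ideal.mul_mem_mul ha hb) hc
    have h₂ := mulHom_apply f (mulHom j k g h) ha (Ideal.mul_mem_mul hb hc)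
    rw [mulHom_apply _ _ ha hb] at h₁
    rw [mulHom_apply _ _ hb hc] at h₂
    refine h₁.trans ((mul_assoc _ _ _).trans (h₂.symm.trans ?_))
    exact congrArg (mulHom i (j.mul k) f (mulHom j k g h)) (Subtype.ext (mul_assoc a b c).symm)
  · have e : (⟨(a + b) * c, Ideal.mul_mem_mul (add_mem ha hb) hc⟩ : ((i.mul j).mul k).ideal) =
        ⟨a * c, Ideal.mul_mem_mul ha hc⟩ + ⟨b * c, Ideal.mul_mem_mul hb hc⟩ :=
      Subtype.ext (add_mul a b c)
    rw [e, map_add, map_add, e₁, e₂]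

protected theorem one_mul' (x : RingOfFractions Z) : 1 * x = x := by
  obtain ⟨i, f, rfl⟩ := exists_of x
  change of Z GabrielIndex.top _ * of Z i f = _
  rw [of_mul_of, ← of_restrict (GabrielIndex.le_mul_right GabrielIndex.top i) f]
  congr 1
  refine hom_ext_mul fun x y hx hy => ?_
  rw [mulHom_apply _ _ hx hy]
  exact (map_smul f x ⟨y, hy⟩).symm

/-- The ring structure of `R_Z`. It is commutative, and the product of the classes of
`f : a → R / Γ_Z(R)` and `g : b → R / Γ_Z(R)` is the class of the map on `a * b` that sends
`x * y` to `f x * g y`. -/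
instance : CommRing (RingOfFractions Z) :=
  { (inferInstance : AddCommGroup (RingOfFractions Z)),
    (inferInstance : Mul (RingOfFractions Z)),
    (inferInstance : One (RingOfFractions Z)) with
    left_distrib := fun x y z => map_add (mulMap Z x) y z
    right_distrib := fun x y z => LinearMap.map_add₂ (mulMap Z) x y z
    zero_mul := fun x => LinearMap.map_zero₂ (mulMap Z) x
    mul_zero := fun x => map_zero (mulMap Z x)
    mul_assoc := RingOfFractions.mul_assoc'
    mul_comm := RingOfFractions.mul_comm'
    one_mul := RingOfFractions.one_mul'
    mul_one := fun x => (RingOfFractions.mul_comm' x 1).trans (RingOfFractions.one_mul' x) }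

variable (Z) in
/-- The composite `R → R / Γ_Z(R) ≅ Hom_R(R, R / Γ_Z(R)) → R_Z` of canonical maps, which sends `r`
to the class of `x ↦ x • [r]`. -/
def canonicalMap : R →ₗ[R] RingOfFractions Z :=
  (of Z GabrielIndex.top).comp <|
    (LinearMap.lcomp R (R ⧸ torsionIdeal Z) (Submodule.subtype (⊤ : Ideal R))).comp <|
      (LinearMap.ringLmapEquivSelf R R (R ⧸ torsionIdeal Z)).symm.toLinearMap.comp
        (torsionIdeal Z).mkQ

theorem canonicalMap_one : canonicalMap Z 1 = 1 := by
  refine congrArg (of Z GabrielIndex.top) (LinearMap.ext fun x => ?_)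
  change x.1 • (torsionIdeal Z).mkQ 1 = (torsionIdeal Z).mkQ x.1
  rw [← map_smul, smul_eq_mul, mul_one]

theorem canonicalMap_eq_smul_one (r : R) : canonicalMap Z r = r • 1 := by
  rw [← canonicalMap_one, ← map_smul, smul_eq_mul, mul_one]

protected theorem smul_mul' (r : R) (x y : RingOfFractions Z) : r • x * y = r • (x * y) :=
  LinearMap.map_smul₂ (mulMap Z) r x y

variable (Z) in
/-- The canonical ring homomorphism `μ : R → R_Z`. -/
def canonicalHom : R →+* RingOfFractions Z :=
  { canonicalMap Z with
    map_one' := canonicalMap_one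
    map_zero' := map_zero (canonicalMap Z)
    map_mul' := fun r s => by
      change canonicalMap Z (r * s) = canonicalMap Z r * canonicalMap Z s
      rw [canonicalMap_eq_smul_one r, RingOfFractions.smul_mul', one_mul, ← map_smul, smul_eq_mul] }

/-- `R_Z` is an `R`-algebra through the canonical homomorphism `μ`, and the `R`-module structure is
that of the direct limit. -/
instance : Algebra R (RingOfFractions Z) where
  algebraMap := canonicalHom Z
  commutes' r x := mul_comm _ _
  smul_def' r x := by
    change _ = canonicalMap Z r * x
    rw [canonicalMap_eq_smul_one, RingOfFractions.smul_mul', one_mul]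

end RingOfFractions

/-- `Z` is perfect if `R_Z` is flat as an `R`-module and `Z` consists of the primes `p` such that
`μ(p) R_Z = R_Z`, where `μ : R → R_Z` is the canonical ring homomorphism. -/
def IsPerfect : Prop :=
  Module.Flat R (RingOfFractions Z) ∧
    Z = {p | p.asIdeal.map (RingOfFractions.canonicalHom Z) = ⊤}

end RingOfFractions

end SpecLocalization

end

/-
If `R_Z` is flat and `μ(p) R_Z = R_Z` for all `p ∈ Z`, then `R → R_Z` is a flat epimorphism, so
that extension of scalars is exact and has a fully faithful right adjoint. The modules it kills are
those supported on the primes with `μ(p) R_Z = R_Z`, so it is the quotient functor by `𝒯_Z`.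

Conversely, let `L : R-Mod ⥤ A-Mod` be a quotient functor by `𝒯_Z`, and let `B = L(R)`. Every
`L(X)` is the sum of the images of the maps `B → L(X)` induced by the elements of `X`. Hence `B`
generates `A-Mod`, and the natural map `X ⊗ B → L(X)` is surjective; as `L` is exact, it is
bijective. It follows that `B` is flat over `R`, and that `p B = B` if and only if `L(R / p) = 0`,
that is, `p ∈ Z`. A calculus of fractions identifies `R_Z` with `End_A(B)`, which is therefore
commutative, and a generator with commutative endomorphism ring is finitely generated and
projective. Thus `End_A(B)` is a direct summand of a power of `B`, and both properties pass from
`B` to `R_Z`.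
-/

noncomputable section

namespace SpecLocalization

open TensorProduct

section TraceIdeal

variable (A : Type*) [Ring A] (B : Type*) [AddCommGroup B] [Module A B]

/-- The trace ideal of a module `B`: the sum of the images of all linear maps `B → A`. It is the
unit ideal if and only if `B` is a generator of the category of `A`-modules. -/
def traceIdeal : Ideal A := ⨆ f : Module.Dual A B, LinearMap.range f

/-- The ideal of the endomorphisms of `B` that factor through a finite free module. It is
generated, as a left ideal, by the endomorphisms `x ↦ f x • c` with `f : B → A` and `c : B`. -/
def finiteRankEnd : Ideal (Module.End A B) :=
  Ideal.span (Set.range fun p : Module.Dual A B × B => p.1.smulRight p.2)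

variable {A B}

theorem smulRight_mem_finiteRankEnd (f : Module.Dual A B) (c : B) :
    f.smulRight c ∈ finiteRankEnd A B :=
  Ideal.subset_span ⟨(f, c), rfl⟩

theorem exists_sum_smulRight_smul_eq (h : traceIdeal A B = ⊤) :
    ∃ (s : Finset (Module.Dual A B)) (b : Module.Dual A B → B),
      ∀ x : B, ∑ f ∈ s, (f.smulRight x : Module.End A B) • b f = x := by
  obtain ⟨F, hF, hF1⟩ := (Submodule.mem_iSup_iff_exists_finsupp _ _).1
    (h ▸ Submodule.mem_top : (1 : A) ∈ traceIdeal A B)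
  choose b hb using hF
  refine ⟨F.support, b, fun x => ?_⟩
  simp only [Module.End.smul_def, LinearMap.smulRight_apply, hb, ← Finset.sum_smul]
  exact (congrArg (· • x) hF1).trans (one_smul A x)

theorem finite_end_of_traceIdeal_eq_top (h : traceIdeal A B = ⊤) :
    Module.Finite (Module.End A B) B := by
  classical
  obtain ⟨s, b, hb⟩ := exists_sum_smulRight_smul_eq h
  refine ⟨s.image b, top_le_iff.1 fun x _ => ?_⟩
  rw [← hb x]
  exact sum_mem fun f hf =>
    Submodule.smul_mem _ _ (Submodule.subset_span (Finset.mem_image_of_mem b hf))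

theorem finiteRankEnd_smul_top_of_traceIdeal_eq_top (h : traceIdeal A B = ⊤) :
    finiteRankEnd A B • (⊤ : Submodule (Module.End A B) B) = ⊤ := by
  obtain ⟨s, b, hb⟩ := exists_sum_smulRight_smul_eq h
  refine top_le_iff.1 fun x _ => ?_
  rw [← hb x]
  exact sum_mem fun f _ => Submodule.smul_mem_smul (smulRight_mem_finiteRankEnd f x) trivial

theorem finiteRankEnd_eq_top_of_traceIdeal_eq_top [IsMulCommutative (Module.End A B)]
    (h : traceIdeal A B = ⊤) : finiteRankEnd A B = ⊤ := by
  let _ : CommRing (Module.End A B) :=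
    { (inferInstance : Ring (Module.End A B)) with mul_comm := mul_comm' }
  have := finite_end_of_traceIdeal_eq_top h
  -- Nakayama: some `r ≡ 1` modulo the ideal annihilates `B`, so that `r = 0` in `End B`.
  obtain ⟨r, hr, hr0⟩ := Submodule.exists_sub_one_mem_and_smul_eq_zero_of_fg_of_le_smul
    (finiteRankEnd A B) (⊤ : Submodule (Module.End A B) B) Module.Finite.fg_top
    (finiteRankEnd_smul_top_of_traceIdeal_eq_top h).ge
  obtain rfl : r = 0 := LinearMap.ext fun x => hr0 x trivial
  rw [zero_sub] at hr
  exact (Ideal.eq_top_iff_one _).2 (neg_mem_iff.1 hr)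

theorem exists_dualBasis_of_finiteRankEnd_eq_top (h : finiteRankEnd A B = ⊤) :
    ∃ (n : ℕ) (g : Fin n → Module.Dual A B) (c : Fin n → B), ∀ x, ∑ i, g i x • c i = x := by
  obtain ⟨n, σ, φ, hφ⟩ := Submodule.mem_span_set'.1
    (h ▸ Submodule.mem_top : (1 : Module.End A B) ∈ finiteRankEnd A B)
  choose p hp using fun i => (φ i).2
  refine ⟨n, fun i => (p i).1, fun i => σ i (p i).2, fun x => ?_⟩
  simpa [← hp] using LinearMap.congr_fun hφ x

theorem finite_of_dualBasis {n : ℕ} {g : Fin n → Module.Dual A B} {c : Fin n → B}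
    (h : ∀ x, ∑ i, g i x • c i = x) : Module.Finite A B :=
  .of_surjective (Fintype.linearCombination A c) fun x => ⟨fun i => g i x, h x⟩

theorem projective_of_dualBasis {n : ℕ} {g : Fin n → Module.Dual A B} {c : Fin n → B}
    (h : ∀ x, ∑ i, g i x • c i = x) : Module.Projective A B :=
  .of_split (LinearMap.pi g) (Fintype.linearCombination A c) (LinearMap.ext h)

end TraceIdeal

section SMulTop

variable {R M N : Type*} [CommRing R] [AddCommGroup M] [Module R M] [AddCommGroup N] [Module R N]

theorem smul_top_eq_top_of_iSup_range_eq_top {I : Ideal R} {κ : Type*} (f : κ → M →ₗ[R] N)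
    (hf : ⨆ k, LinearMap.range (f k) = ⊤) (hM : I • (⊤ : Submodule R M) = ⊤) :
    I • (⊤ : Submodule R N) = ⊤ := by
  simp only [← hf, Submodule.smul_iSup, LinearMap.range_eq_map, ← Submodule.map_smul'', hM]

theorem smul_top_eq_top_iff_of_linearEquiv (I : Ideal R) (e : M ≃ₗ[R] N) :
    I • (⊤ : Submodule R M) = ⊤ ↔ I • (⊤ : Submodule R N) = ⊤ := by
  rw [← (Submodule.map_injective_of_injective e.injective).eq_iff, Submodule.map_smul'',
    Submodule.map_top, LinearEquiv.range]

theorem map_algebraMap_eq_top_iff {S : Type*} [CommRing S] [Algebra R S] (I : Ideal R) :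
    I.map (algebraMap R S) = ⊤ ↔ I • (⊤ : Submodule R S) = ⊤ := by
  rw [Ideal.smul_top_eq_map, Submodule.restrictScalars_eq_top_iff]

end SMulTop

section RetractEnd

variable {R A B : Type*} [CommRing R] [Ring A] [AddCommGroup B] [Module A B] [Module R B]
  [SMulCommClass A R B] [Module.Finite A B] [Module.Projective A B]

variable (R A B) in
theorem exists_end_retract_pi :
    ∃ (n : ℕ) (ι : Module.End A B →ₗ[R] Fin n → B) (ρ : (Fin n → B) →ₗ[R] Module.End A B),
      ρ ∘ₗ ι = LinearMap.id := by
  obtain ⟨n, p, s, -, -, hps⟩ := Module.Finite.exists_comp_eq_id_of_projective A B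
  let e := LinearEquiv.piRing A B (Fin n) R
  refine ⟨n, e ∘ₗ LinearMap.lcomp R B p, LinearMap.lcomp R B s ∘ₗ e.symm, ?_⟩
  ext φ x
  simpa using congrArg φ (LinearMap.congr_fun hps x)

theorem flat_end [Module.Flat R B] : Module.Flat R (Module.End A B) := by
  obtain ⟨n, ι, ρ, h⟩ := exists_end_retract_pi R A B
  have : Module.Flat R (Fin n → B) :=
    .of_linearEquiv (DirectSum.linearEquivFunOnFintype R (Fin n) fun _ => B).symm
  exact .of_retract ι ρ h

theorem smul_top_end_eq_top_iff (I : Ideal R) :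
    I • (⊤ : Submodule R (Module.End A B)) = ⊤ ↔ I • (⊤ : Submodule R B) = ⊤ := by
  constructor
  · refine smul_top_eq_top_of_iSup_range_eq_top
      (fun x : B => (LinearMap.applyₗ' (R := A) R (M₂ := B) x)) (top_le_iff.1 fun x _ => ?_)
    exact Submodule.mem_iSup_of_mem x ⟨1, rfl⟩
  · obtain ⟨n, ι, ρ, h⟩ := exists_end_retract_pi R A B
    refine smul_top_eq_top_of_iSup_range_eq_top
      (fun i => ρ ∘ₗ LinearMap.single R (fun _ => B) i) (top_le_iff.1 fun φ _ => ?_)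
    have hφ : ∑ i, ρ (Pi.single i (ι φ i)) = φ := by
      rw [← map_sum, Finset.univ_sum_single]
      exact LinearMap.congr_fun h φ
    exact hφ ▸ sum_mem fun i _ => Submodule.mem_iSup_of_mem i ⟨ι φ i, rfl⟩

end RetractEnd

section FlatEpimorphism

variable {R S : Type*} [CommRing R] [CommRing S] [Algebra R S]

theorem map_eq_top_of_forall_prime {I : Ideal R}
    (h : ∀ p : PrimeSpectrum R, I ≤ p.asIdeal → p.asIdeal.map (algebraMap R S) = ⊤) :
    I.map (algebraMap R S) = ⊤ := by
  by_contra hI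
  obtain ⟨m, hm, hle⟩ := Ideal.exists_le_maximal _ hI
  have := hm.isPrime
  have hp := h ⟨m.comap (algebraMap R S), inferInstance⟩ (Ideal.map_le_iff_le_comap.1 hle)
  exact hm.ne_top (top_le_iff.1 (hp.ge.trans Ideal.map_comap_le))

theorem eq_zero_of_map_eq_top {N : Type*} [AddCommGroup N] [Module R N] [Module S N]
    [IsScalarTower R S N] {I : Ideal R} (hI : I.map (algebraMap R S) = ⊤) {n : N}
    (h : ∀ x ∈ I, x • n = 0) : n = 0 := by
  have hle : I.map (algebraMap R S) ≤ LinearMap.ker (LinearMap.toSpanSingleton S N n) :=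
    Ideal.map_le_iff_le_comap.2 fun x hx => by simpa using h x hx
  simpa using hle (hI ▸ Submodule.mem_top : (1 : S) ∈ I.map (algebraMap R S))

theorem isEpi_of_forall_exists_map_eq_top
    (h : ∀ s : S, ∃ I : Ideal R, I.map (algebraMap R S) = ⊤ ∧
      ∀ x ∈ I, ∃ r : R, x • s = algebraMap R S r) : Algebra.IsEpi R S := by
  refine (Algebra.isEpi_iff_forall_one_tmul_eq R S).2 fun s => ?_
  obtain ⟨I, hI, hs⟩ := h s
  refine sub_eq_zero.1 (eq_zero_of_map_eq_top hI fun x hx => ?_)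
  obtain ⟨r, hr⟩ := hs x hx
  rw [smul_sub, ← tmul_smul, smul_tmul', hr, Algebra.algebraMap_eq_smul_one, smul_tmul, sub_self]

theorem map_smul_of_isEpi [Algebra.IsEpi R S] {M N : Type*} [AddCommGroup M] [Module R M]
    [Module S M] [IsScalarTower R S M] [AddCommGroup N] [Module R N] [Module S N]
    [IsScalarTower R S N] (f : M →ₗ[R] N) (s : S) (m : M) : f (s • m) = s • f m := by
  let F : S ⊗[R] S →ₗ[R] N := TensorProduct.lift <|
    (LinearMap.lsmul S N).restrictScalars₁₂ R R |>.compl₂ <|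
      f ∘ₗ (LinearMap.toSpanSingleton S M m).restrictScalars R
  simpa [F] using congrArg F ((Algebra.isEpi_iff_forall_one_tmul_eq R S).1 inferInstance s)

theorem subsingleton_tensorProduct_quotient_iff (I : Ideal R) :
    Subsingleton (S ⊗[R] (R ⧸ I)) ↔ I.map (algebraMap R S) = ⊤ := by
  rw [(TensorProduct.tensorQuotEquivQuotSMul S I).toEquiv.subsingleton_congr,
    Submodule.Quotient.subsingleton_iff, map_algebraMap_eq_top_iff]

theorem map_annihilator_span_singleton_eq_top [Module.Flat R S] {M : Type*} [AddCommGroup M]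
    [Module R M] [Subsingleton (S ⊗[R] M)] (m : M) :
    (R ∙ m).annihilator.map (algebraMap R S) = ⊤ := by
  rw [← subsingleton_tensorProduct_quotient_iff, Submodule.annihilator_span_singleton]
  let ψ := LinearMap.toSpanSingleton R M m
  have hψ : Function.Injective (ψ.ker.liftQ ψ le_rfl) :=
    LinearMap.ker_eq_bot.1 (Submodule.ker_liftQ_eq_bot _ _ _ le_rfl)
  exact (Module.Flat.lTensor_preserves_injective_linearMap (M := S) _ hψ).subsingleton

theorem subsingleton_tensorProduct_iff [Module.Flat R S] (M : Type*) [AddCommGroup M]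
    [Module R M] : Subsingleton (S ⊗[R] M) ↔
      Module.support R M ⊆ {p | p.asIdeal.map (algebraMap R S) = ⊤} := by
  constructor
  · intro h p hp
    obtain ⟨m, hm⟩ := Module.mem_support_iff_exists_annihilator.1 hp
    exact top_le_iff.1
      ((map_annihilator_span_singleton_eq_top (S := S) m).ge.trans (Ideal.map_mono hm))
  · intro h
    refine subsingleton_of_forall_eq 0 fun z => ?_
    induction z with
    | zero => rfl
    | add x y hx hy => rw [hx, hy, add_zero]
    | tmul s m =>
      have hI : (R ∙ m).annihilator.map (algebraMap R S) = ⊤ := map_eq_top_of_forall_prime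
        fun p hp => h (Module.mem_support_iff_exists_annihilator.2 ⟨m, hp⟩)
      refine eq_zero_of_map_eq_top hI fun x hx => ?_
      rw [← tmul_smul, (Submodule.mem_annihilator_span_singleton _ _).1 hx, tmul_zero]

end FlatEpimorphism

section ExtendScalars

variable (R S : Type u) [CommRing R] [CommRing S] [Algebra R S]

theorem full_restrictScalars_of_isEpi [Algebra.IsEpi R S] :
    (ModuleCat.restrictScalars.{u} (algebraMap R S)).Full where
  map_surjective {M N} f := by
    let _ : Module R M := Module.compHom M (algebraMap R S)
    let _ : Module R N := Module.compHom N (algebraMap R S)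
    have : IsScalarTower R S M := .of_algebraMap_smul fun _ _ => rfl
    have : IsScalarTower R S N := .of_algebraMap_smul fun _ _ => rfl
    let g : M →ₗ[R] N := f.hom
    exact ⟨ModuleCat.ofHom { g with map_smul' := map_smul_of_isEpi g }, rfl⟩

theorem isZero_extendScalars_obj_iff [Module.Flat R S] (M : ModuleCat.{u} R) :
    Limits.IsZero ((ModuleCat.extendScalars.{u, u, u} (algebraMap R S)).obj M) ↔
      torsionClass {p | p.asIdeal.map (algebraMap R S) = ⊤} M := by
  refine .trans ?_ (subsingleton_tensorProduct_iff (S := S) M)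
  rw [ModuleCat.isZero_iff_subsingleton]
  let e : (ModuleCat.restrictScalars (algebraMap R S)).obj (ModuleCat.of S S) ≃ₗ[R] S :=
    { AddEquiv.refl S with map_smul' := fun r s => (Algebra.smul_def (A := S) r s).symm }
  exact (TensorProduct.congr e (LinearEquiv.refl R M)).toEquiv.subsingleton_congr

theorem isLocalization_extendScalars [Module.Flat R S] [Algebra.IsEpi R S] :
    (ModuleCat.extendScalars.{u, u, u} (algebraMap R S)).IsLocalization
      (torsionClass {p | p.asIdeal.map (algebraMap R S) = ⊤}).isoModSerre := by
  let G := ModuleCat.extendScalars.{u, u, u} (algebraMap R S)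
  let adj : G ⊣ ModuleCat.restrictScalars.{u} (algebraMap R S) :=
    ModuleCat.extendRestrictScalarsAdj _
  have : Limits.PreservesFiniteLimits G :=
    ModuleCat.preservesFiniteLimits_extendScalars_of_flat
      (RingHom.flat_algebraMap_iff.2 inferInstance)
  have : Limits.PreservesFiniteColimits G :=
    have := adj.leftAdjoint_preservesColimits
    inferInstance
  have := full_restrictScalars_of_isEpi R S
  have hG : G.kernel = torsionClass {p | p.asIdeal.map (algebraMap R S) = ⊤} :=
    funext fun M => propext (isZero_extendScalars_obj_iff R S M)
  have hloc := Abelian.isLocalization_isoModSerre_kernel_of_leftAdjoint adj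
  convert hloc
  exact hG.symm

end ExtendScalars

section Perfect

variable {R : Type u} [CommRing R] {Z : Set (PrimeSpectrum R)}

theorem RingOfFractions.exists_smul_eq_algebraMap (s : RingOfFractions Z) :
    ∃ I ∈ gabrielTopology Z, ∀ x ∈ I, ∃ r : R, x • s = algebraMap R (RingOfFractions Z) r := by
  obtain ⟨i, f, rfl⟩ := exists_of s
  refine ⟨i.ideal, i.ideal_mem, fun x hx => ?_⟩
  obtain ⟨r, hr⟩ := (torsionIdeal Z).mkQ_surjective (f ⟨x, hx⟩)
  refine ⟨r, ?_⟩
  have hle : GabrielIndex.top ≤ i := (le_top : i.ideal ≤ ⊤)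
  rw [← map_smul]
  change _ = of Z GabrielIndex.top _
  rw [← of_restrict hle]
  congr 1
  ext y
  change x • f y = y.1 • (torsionIdeal Z).mkQ r
  rw [hr, ← map_smul, ← map_smul]
  exact congrArg f (Subtype.ext (mul_comm _ _))

theorem IsPerfect.isEpi (h : IsPerfect Z) : Algebra.IsEpi R (RingOfFractions Z) := by
  refine isEpi_of_forall_exists_map_eq_top fun s => ?_
  obtain ⟨I, hI, hs⟩ := s.exists_smul_eq_algebraMap
  exact ⟨I, map_eq_top_of_forall_prime fun p hp =>
    h.2.le (mem_gabrielTopology_iff.1 hI hp), hs⟩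

theorem isModuleCategory_of_isPerfect (h : IsPerfect Z) :
    IsModuleCategory.{u} (QuotientCategory Z) := by
  have := h.1
  have := h.isEpi
  have hZ : Z = {p | p.asIdeal.map (algebraMap R (RingOfFractions Z)) = ⊤} := h.2
  let G := ModuleCat.extendScalars.{u, u, u} (algebraMap R (RingOfFractions Z))
  have : G.IsLocalization (torsionClass Z).isoModSerre := by
    have := isLocalization_extendScalars R (RingOfFractions Z)
    convert this
  exact ⟨RingOfFractions Z, inferInstance,
    ⟨Localization.uniq (torsionClass Z).isoModSerre.Q G (torsionClass Z).isoModSerre⟩⟩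

end Perfect

section Torsion

variable {R : Type u} [CommRing R] {Z : Set (PrimeSpectrum R)}

theorem torsionClass_of_iff {M : Type u} [AddCommGroup M] [Module R M] :
    torsionClass Z (ModuleCat.of R M) ↔ ∀ m : M, m ∈ torsionRadical Z M := by
  simp only [mem_torsionRadical_iff]
  constructor
  · intro h m p hp
    exact Module.notMem_support_iff'.1 (fun hs => hp (h hs)) m
  · intro h p hp
    by_contra hpZ
    exact Module.notMem_support_iff'.2 (fun m => h m p hpZ) hp

theorem map_mem_torsionRadical_iff {M N : Type u} [AddCommGroup M] [Module R M]
    [AddCommGroup N] [Module R N] {f : M →ₗ[R] N} (hf : Function.Injective f) {m : M} :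
    f m ∈ torsionRadical Z N ↔ m ∈ torsionRadical Z M := by
  simp only [mem_torsionRadical_iff, ← map_smul, map_eq_zero_iff f hf]

theorem torsionClass_of_submodule_iff {M : Type u} [AddCommGroup M] [Module R M]
    {N : Submodule R M} : torsionClass Z (ModuleCat.of R N) ↔ N ≤ torsionRadical Z M := by
  rw [torsionClass_of_iff, SetLike.forall, SetLike.le_def]
  exact forall₂_congr fun x hx => (map_mem_torsionRadical_iff N.subtype_injective).symm

theorem torsionClass_image_iff {M N : ModuleCat.{u} R} (f : M ⟶ N) :
    torsionClass Z (Abelian.image f) ↔ LinearMap.range f.hom ≤ torsionRadical Z N :=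
  ((torsionClass Z).prop_iff_of_iso
    (Abelian.imageIsoImage f ≪≫ ModuleCat.imageIsoRange f)).trans torsionClass_of_submodule_iff

theorem isoModSerre_subtype {I : Ideal R} (hI : I ∈ gabrielTopology Z) :
    (torsionClass Z).isoModSerre (ModuleCat.ofHom I.subtype) := by
  have : Mono (ModuleCat.ofHom I.subtype) :=
    (ModuleCat.mono_iff_injective _).2 I.subtype_injective
  refine (torsionClass Z).isoModSerre_of_mono _
    (((torsionClass Z).prop_iff_of_iso (ModuleCat.cokernelIsoRangeQuotient _)).2 ?_)
  change torsionClass Z (ModuleCat.of R (R ⧸ LinearMap.range I.subtype))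
  rwa [Submodule.range_subtype]

theorem isoModSerre_mkQ_torsionRadical (M : Type u) [AddCommGroup M] [Module R M] :
    (torsionClass Z).isoModSerre (ModuleCat.ofHom (torsionRadical Z M).mkQ) := by
  have : Epi (ModuleCat.ofHom (torsionRadical Z M).mkQ) :=
    (ModuleCat.epi_iff_surjective _).2 (Submodule.mkQ_surjective _)
  refine (torsionClass Z).isoModSerre_of_epi _
    (((torsionClass Z).prop_iff_of_iso (ModuleCat.kernelIsoKer _)).2 ?_)
  exact torsionClass_of_submodule_iff.2 (Submodule.ker_mkQ _).le

theorem range_mem_gabrielTopology {X : ModuleCat.{u} R} {w : X ⟶ ModuleCat.of R R}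
    (hw : (torsionClass Z).isoModSerre w) : LinearMap.range w.hom ∈ gabrielTopology Z :=
  ((torsionClass Z).prop_iff_of_iso (ModuleCat.cokernelIsoRangeQuotient w)).1 hw.2

theorem torsionClass_quotient_asIdeal_iff (hZ : StableUnderSpecialization Z)
    (p : PrimeSpectrum R) : torsionClass Z (ModuleCat.of R (R ⧸ p.asIdeal)) ↔ p ∈ Z := by
  refine mem_gabrielTopology_iff.trans ⟨fun h => h (le_refl p.asIdeal), fun hp q hq => ?_⟩
  exact hZ ((PrimeSpectrum.le_iff_specializes p q).1 hq) hp

end Torsion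

section ModuleOfFractions

variable {R : Type u} [CommRing R] (Z : Set (PrimeSpectrum R)) {E : Type u} [AddCommGroup E]
  [Module R E]

/-- An `R`-module `E` with a distinguished element `e` is a module of fractions of `R` with respect
to `Z` if the kernel and the cokernel of `r ↦ r • e` are torsion, `E` is torsion-free, and every
homomorphism to `R / Γ_Z(R)` from an ideal in the Gabriel topology is multiplication by an element
of `E`. The pair `(E, e)` is then isomorphic to `R_Z` with its unit element. -/
structure IsModuleOfFractions (e : E) : Prop where
  smul_eq_zero_iff : ∀ r : R, r • e = 0 ↔ r ∈ torsionIdeal Z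
  exists_smul_eq : ∀ s : E, ∃ I ∈ gabrielTopology Z, ∀ a ∈ I, ∃ r : R, a • s = r • e
  eq_zero : ∀ I ∈ gabrielTopology Z, ∀ s : E, (∀ a ∈ I, a • s = 0) → s = 0
  exists_extension : ∀ I ∈ gabrielTopology Z, ∀ f : I →ₗ[R] R ⧸ torsionIdeal Z,
    ∃ s : E, ∀ (a : I) (r : R), f a = Submodule.Quotient.mk r → (a : R) • s = r • e

namespace IsModuleOfFractions

variable {Z} {e : E} (h : IsModuleOfFractions Z e)
include h

/-- The embedding of `R / Γ_Z(R)` into a module of fractions. -/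
def quotientMap : R ⧸ torsionIdeal Z →ₗ[R] E :=
  (torsionIdeal Z).liftQ (LinearMap.toSpanSingleton R E e) fun r hr => (h.smul_eq_zero_iff r).2 hr

theorem quotientMap_injective : Function.Injective h.quotientMap :=
  LinearMap.ker_eq_bot.1 (Submodule.ker_liftQ_eq_bot _ _ _ fun r hr => (h.smul_eq_zero_iff r).1 hr)

theorem eq_of_forall_smul_eq {I : Ideal R} (hI : I ∈ gabrielTopology Z) {s t : E}
    (hst : ∀ a ∈ I, a • s = a • t) : s = t :=
  sub_eq_zero.1 <| h.eq_zero I hI _ fun a ha => by rw [smul_sub, hst a ha, sub_self]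

theorem exists_smul_eq_quotientMap (i : GabrielIndex Z) (f : FractionHom Z i) :
    ∃ s : E, ∀ a : i.ideal, (a : R) • s = h.quotientMap (f a) := by
  obtain ⟨s, hs⟩ := h.exists_extension i.ideal i.ideal_mem f
  refine ⟨s, fun a => ?_⟩
  obtain ⟨r, hr⟩ := Submodule.Quotient.mk_surjective _ (f a)
  rw [hs a r hr.symm, ← hr]
  rfl

/-- The unique element `s` of `E` such that `a • s` is the image of `f a` for all `a` in the
domain of `f`. -/
def extension (i : GabrielIndex Z) : FractionHom Z i →ₗ[R] E where
  toFun f := (h.exists_smul_eq_quotientMap i f).choose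
  map_add' f g := h.eq_of_forall_smul_eq i.ideal_mem fun a ha => by
    have hs := fun f => (h.exists_smul_eq_quotientMap i f).choose_spec ⟨a, ha⟩
    rw [hs, smul_add, hs, hs, LinearMap.add_apply, map_add]
  map_smul' r f := h.eq_of_forall_smul_eq i.ideal_mem fun a ha => by
    have hs := fun f => (h.exists_smul_eq_quotientMap i f).choose_spec ⟨a, ha⟩
    rw [hs, smul_comm, hs, LinearMap.smul_apply, map_smul, RingHom.id_apply]

theorem smul_extension {i : GabrielIndex Z} (f : FractionHom Z i) (a : i.ideal) :
    (a : R) • h.extension i f = h.quotientMap (f a) :=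
  (h.exists_smul_eq_quotientMap i f).choose_spec a

theorem extension_eq_iff {i : GabrielIndex Z} {f : FractionHom Z i} {s : E} :
    h.extension i f = s ↔ ∀ a : i.ideal, h.quotientMap (f a) = (a : R) • s := by
  refine ⟨?_, fun hs => h.eq_of_forall_smul_eq i.ideal_mem fun a ha =>
    (h.smul_extension f ⟨a, ha⟩).trans (hs _)⟩
  rintro rfl a
  exact (h.smul_extension f a).symm

/-- The comparison map from the ring of fractions. -/
def ofRingOfFractions : RingOfFractions Z →ₗ[R] E :=
  RingOfFractions.lift h.extension fun _ _ hij f =>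
    h.extension_eq_iff.2 fun a => (h.smul_extension f ⟨a, GabrielIndex.ideal_le hij a.2⟩).symm

theorem ofRingOfFractions_injective : Function.Injective h.ofRingOfFractions := by
  refine (injective_iff_map_eq_zero _).2 fun z hz => ?_
  obtain ⟨i, f, rfl⟩ := RingOfFractions.exists_of z
  rw [ofRingOfFractions, RingOfFractions.lift_of, extension_eq_iff] at hz
  obtain rfl : f = 0 := LinearMap.ext fun a =>
    (map_eq_zero_iff _ h.quotientMap_injective).1 ((hz a).trans (smul_zero _))
  exact map_zero _

theorem ofRingOfFractions_surjective : Function.Surjective h.ofRingOfFractions := by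
  intro s
  obtain ⟨I, hI, hs⟩ := h.exists_smul_eq s
  let i : GabrielIndex Z := OrderDual.toDual ⟨I, hI⟩
  let g : i.ideal →ₗ[R] LinearMap.range h.quotientMap :=
    (LinearMap.toSpanSingleton R E s ∘ₗ I.subtype).codRestrict _ fun a => by
      obtain ⟨r, hr⟩ := hs a a.2
      exact ⟨Submodule.Quotient.mk r, hr.symm⟩
  let σ := LinearEquiv.ofInjective h.quotientMap h.quotientMap_injective
  refine ⟨RingOfFractions.of Z i (σ.symm ∘ₗ g), ?_⟩
  rw [ofRingOfFractions, RingOfFractions.lift_of, extension_eq_iff]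
  exact fun a => congrArg Subtype.val (σ.apply_symm_apply (g a))

/-- A module of fractions is isomorphic to the ring of fractions. -/
def ringOfFractionsEquiv : RingOfFractions Z ≃ₗ[R] E :=
  .ofBijective h.ofRingOfFractions ⟨h.ofRingOfFractions_injective, h.ofRingOfFractions_surjective⟩

end IsModuleOfFractions

end ModuleOfFractions

section CommutativeModuleOfFractions

variable {R E : Type u} [CommRing R] {Z : Set (PrimeSpectrum R)} [Ring E] [Module R E]
  [IsScalarTower R E E] [SMulCommClass R E E]

theorem IsModuleOfFractions.isMulCommutative (h : IsModuleOfFractions Z (1 : E)) :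
    IsMulCommutative E := by
  refine ⟨⟨fun s t => ?_⟩⟩
  obtain ⟨I, hI, hs⟩ := h.exists_smul_eq s
  refine h.eq_of_forall_smul_eq hI fun a ha => ?_
  obtain ⟨r, hr⟩ := hs a ha
  rw [← smul_mul_assoc, ← mul_smul_comm, hr, smul_one_mul, mul_smul_comm, mul_one]

end CommutativeModuleOfFractions

section TensorProductPi

variable {R M N : Type*} [CommRing R] [AddCommGroup M] [Module R M] [AddCommGroup N] [Module R N]

theorem exists_rTensor_pi_eq (z : M ⊗[R] N) :
    ∃ (S : Finset (M × N)) (φ : (S → R) →ₗ[R] M) (y : (S → R) ⊗[R] N),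
      φ.rTensor N y = z := by
  classical
  obtain ⟨S, rfl⟩ := TensorProduct.exists_finset z
  refine ⟨S, Fintype.linearCombination R (·.1.1), ∑ i, Pi.single i 1 ⊗ₜ i.1.2, ?_⟩
  simp [← S.sum_coe_sort]

theorem eq_zero_of_forall_rTensor_proj_eq_zero {ι : Type*} [Finite ι] {z : (ι → R) ⊗[R] N}
    (h : ∀ i, (LinearMap.proj (R := R) (φ := fun _ : ι => R) i).rTensor N z = 0) : z = 0 := by
  classical
  have := Fintype.ofFinite ι
  have hid : ∑ i, LinearMap.single R (fun _ : ι => R) i ∘ₗ LinearMap.proj i = LinearMap.id :=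
    LinearMap.ext fun x => by simpa using Finset.univ_sum_single x
  rw [← LinearMap.rTensor_id_apply N (ι → R) z, ← hid, ← LinearMap.coe_rTensorHom, map_sum,
    LinearMap.sum_apply]
  exact Finset.sum_eq_zero fun i _ => by
    rw [LinearMap.coe_rTensorHom, LinearMap.rTensor_comp_apply, h, map_zero]

end TensorProductPi

section ElementHom

variable {R : Type u} [CommRing R] {X Y : ModuleCat.{u} R}

/-- The morphism `R ⟶ X` that corresponds to an element of `X`. -/
def elementHom (x : X) : ModuleCat.of R R ⟶ X :=
  ModuleCat.ofHom (LinearMap.toSpanSingleton R X x)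

theorem elementHom_comp (x : X) (f : X ⟶ Y) : elementHom x ≫ f = elementHom (f.hom x) :=
  ModuleCat.hom_ext (LinearMap.comp_toSpanSingleton f.hom x)

theorem elementHom_add (x y : X) : elementHom (x + y) = elementHom x + elementHom y :=
  ModuleCat.hom_ext (LinearMap.toSpanSingleton_add x y)

theorem elementHom_smul (r : R) (x : X) : elementHom (r • x) = r • elementHom x :=
  ModuleCat.hom_ext (LinearMap.toSpanSingleton_smul r x)

theorem elementHom_eq_smul_id (r : R) :
    elementHom (X := ModuleCat.of R R) r = r • 𝟙 (ModuleCat.of R R) := by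
  ext; simp [elementHom]

end ElementHom

section FunctorAction

variable {R : Type u} [CommRing R] {A : Type u} [Ring A]
  (L : ModuleCat.{u} R ⥤ ModuleCat.{u} A) [L.Additive] (X : ModuleCat.{u} R)

/-- The action of `R` on `L(X)` by functoriality. -/
abbrev objModule : Module R (L.obj X) where
  smul r b := (L.map (r • 𝟙 X)).hom b
  one_smul b := by change (L.map _).hom b = b; simp
  mul_smul r s b := by
    change (L.map _).hom b = (L.map _).hom ((L.map _).hom b)
    rw [← ModuleCat.comp_apply, ← L.map_comp, Linear.smul_comp, Category.id_comp, smul_smul,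
      mul_comm]
  smul_zero r := map_zero _
  smul_add r := map_add (L.map _).hom
  add_smul r s b := by
    change (L.map _).hom b = (L.map _).hom b + (L.map _).hom b
    rw [add_smul, L.map_add]; rfl
  zero_smul b := by
    change (L.map _).hom b = 0
    rw [zero_smul, L.map_zero]; rfl

attribute [local instance] objModule

variable {L X} in
theorem obj_smul_def (r : R) (b : L.obj X) : r • b = (L.map (r • 𝟙 X)).hom b := rfl

theorem obj_smulCommClass : SMulCommClass A R (L.obj X) where
  smul_comm a r b := (map_smul (L.map (r • 𝟙 X)).hom a b).symm

attribute [local instance] obj_smulCommClass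

variable {X} {Y : ModuleCat.{u} R}

theorem map_smul_apply (r : R) (f : X ⟶ Y) (b : L.obj X) :
    (L.map (r • f)).hom b = r • (L.map f).hom b := by
  rw [obj_smul_def, ← ModuleCat.comp_apply, ← L.map_comp, Linear.comp_smul, Category.comp_id]

theorem map_apply_smul (r : R) (f : X ⟶ Y) (b : L.obj X) :
    (L.map f).hom (r • b) = r • (L.map f).hom b := by
  rw [obj_smul_def, ← ModuleCat.comp_apply, ← L.map_comp, Linear.smul_comp, Category.id_comp,
    map_smul_apply]

/-- The image of the free module of rank one under `L`. -/
abbrev Fiber : Type u := L.obj (ModuleCat.of R R)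

variable (X) in
/-- The Eilenberg–Watts comparison map, which sends `x ⊗ b` to the image of `b` under the map
`L(R) → L(X)` that is induced by `x`. -/
def comparison : X ⊗[R] Fiber L →ₗ[R] L.obj X :=
  TensorProduct.lift <| LinearMap.mk₂ R (fun x b => (L.map (elementHom x)).hom b)
    (fun x y b => by rw [elementHom_add, L.map_add]; rfl)
    (fun r x b => by rw [elementHom_smul, map_smul_apply])
    (fun x b c => map_add _ b c)
    (fun r x b => map_apply_smul L r _ b)

theorem comparison_tmul (x : X) (b : Fiber L) :
    comparison L X (x ⊗ₜ b) = (L.map (elementHom x)).hom b := rfl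

theorem comparison_rTensor (f : X ⟶ Y) (z : X ⊗[R] Fiber L) :
    comparison L Y (f.hom.rTensor (Fiber L) z) = (L.map f).hom (comparison L X z) := by
  induction z with
  | zero => simp
  | add z w hz hw => simp only [map_add, hz, hw]
  | tmul x b =>
    rw [LinearMap.rTensor_tmul, comparison_tmul, comparison_tmul, ← elementHom_comp, L.map_comp,
      ModuleCat.comp_apply]

theorem comparison_self (z : R ⊗[R] Fiber L) :
    comparison L (ModuleCat.of R R) z = TensorProduct.lid R (Fiber L) z := by
  induction z with
  | zero => simp
  | add z w hz hw => simp only [map_add, hz, hw]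
  | tmul r b => rw [comparison_tmul, elementHom_eq_smul_id, ← obj_smul_def, lid_tmul]

theorem comparison_pi_injective (ι : Type u) [Finite ι] :
    Function.Injective (comparison L (ModuleCat.of R (ι → R))) := by
  refine (injective_iff_map_eq_zero (comparison L (ModuleCat.of R (ι → R)))).2 fun z hz => ?_
  refine eq_zero_of_forall_rTensor_proj_eq_zero fun i => ?_
  have hi := comparison_rTensor L (ModuleCat.ofHom (LinearMap.proj (φ := fun _ : ι => R) i)) z
  rw [hz, map_zero] at hi
  exact (TensorProduct.lid R (Fiber L)).map_eq_zero_iff.1 ((comparison_self L _).symm.trans hi)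

variable {L} [Limits.PreservesFiniteLimits L] [Limits.PreservesFiniteColimits L]

theorem map_exact {X Y W : ModuleCat.{u} R} (f : X ⟶ Y) (g : Y ⟶ W)
    (h : Function.Exact f.hom g.hom) : Function.Exact (L.map f).hom (L.map g).hom := by
  have w : f ≫ g = 0 := ModuleCat.hom_ext h.linearMap_comp_eq_zero
  have hS : (ShortComplex.mk f g w).Exact :=
    (ShortComplex.ShortExact.moduleCat_exact_iff_function_exact _).2 h
  exact (ShortComplex.ShortExact.moduleCat_exact_iff_function_exact _).1 (hS.map L)

variable (hL : ∀ X, Function.Surjective (comparison L X))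
include hL

theorem comparison_injective_of_surjective (X : ModuleCat.{u} R) :
    Function.Injective (comparison L X) := by
  refine (injective_iff_map_eq_zero _).2 fun z hz => ?_
  -- Lift `z` to a free module and, by surjectivity of the comparison map, to the kernel of `φ`.
  obtain ⟨S, φ, y, rfl⟩ := exists_rTensor_pi_eq z
  have hexact : Function.Exact (ModuleCat.ofHom (LinearMap.ker φ).subtype).hom
      (ModuleCat.ofHom φ).hom := φ.exact_subtype_ker_map
  obtain ⟨w, hw⟩ := (map_exact (L := L) _ _ hexact (comparison L (.of R (S → R)) y)).1
    ((comparison_rTensor L (ModuleCat.ofHom φ) y).symm.trans hz)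
  obtain ⟨v, rfl⟩ := hL _ w
  rw [← comparison_rTensor] at hw
  rw [← comparison_pi_injective L S hw]
  refine (LinearMap.rTensor_comp_apply (Fiber L) φ (LinearMap.ker φ).subtype v).symm.trans ?_
  simp [LinearMap.comp_ker_subtype]

theorem flat_fiber_of_comparison_surjective : Module.Flat R (Fiber L) := by
  refine Module.Flat.iff_rTensor_preserves_injective_linearMap.2 fun N N' _ _ _ _ f hf => ?_
  have : Mono (ModuleCat.ofHom f) := (ModuleCat.mono_iff_injective _).2 hf
  have hLf : Function.Injective (L.map (ModuleCat.ofHom f)).hom :=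
    (ModuleCat.mono_iff_injective _).1 inferInstance
  refine .of_comp (f := comparison L (ModuleCat.of R N')) ?_
  convert hLf.comp (comparison_injective_of_surjective hL (ModuleCat.of R N)) using 1
  exact funext fun z => comparison_rTensor L (ModuleCat.ofHom f) z

theorem smul_top_fiber_eq_top_iff (I : Ideal R) :
    I • (⊤ : Submodule R (Fiber L)) = ⊤ ↔ Limits.IsZero (L.obj (ModuleCat.of R (R ⧸ I))) := by
  rw [ModuleCat.isZero_iff_subsingleton, ← Submodule.Quotient.subsingleton_iff,
    ← (TensorProduct.quotTensorEquivQuotSMul (Fiber L) I).toEquiv.subsingleton_congr]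
  exact (Equiv.ofBijective (comparison L (ModuleCat.of R (R ⧸ I)))
    ⟨comparison_injective_of_surjective hL _, hL _⟩).subsingleton_congr

end FunctorAction

section LocalizationFunctor

open ObjectProperty

theorem additive_of_isEquivalence {C D : Type*} [Category* C] [Abelian C] [Category* D]
    [Preadditive D] (P : ObjectProperty C) [P.IsSerreClass]
    (F : P.isoModSerre.Localization ⥤ D) [F.IsEquivalence] : F.Additive := by
  have := SerreClassLocalization.hasFiniteProducts P.isoModSerre.Q P
  exact Functor.additive_of_preserves_binary_products F

variable {R : Type u} [CommRing R] (Z : Set (PrimeSpectrum R)) {A : Type u} [Ring A]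
  (L : ModuleCat.{u} R ⥤ ModuleCat.{u} A) [hL : L.IsLocalization (torsionClass Z).isoModSerre]

attribute [local instance] objModule obj_smulCommClass

include Z hL in
theorem map_smul_id_comp {X Y : ModuleCat.{u} R} (r : R) (s : L.obj X ⟶ L.obj Y) :
    L.map (r • 𝟙 X) ≫ s = s ≫ L.map (r • 𝟙 Y) := by
  obtain ⟨φ, rfl⟩ := Localization.exists_rightFraction L (torsionClass Z).isoModSerre s
  have := Localization.inverts L (torsionClass Z).isoModSerre φ.s φ.hs
  have h {X Y : ModuleCat.{u} R} (f : X ⟶ Y) :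
      L.map f ≫ L.map (r • 𝟙 Y) = L.map (r • 𝟙 X) ≫ L.map f := by
    rw [← L.map_comp, ← L.map_comp, Linear.comp_smul, Linear.smul_comp, Category.comp_id,
      Category.id_comp]
  rw [← cancel_epi (L.map φ.s), reassoc_of% h φ.s,
    MorphismProperty.RightFraction.map_s_comp_map,
    MorphismProperty.RightFraction.map_s_comp_map_assoc, h]

variable [L.Additive]

include Z hL in
theorem hom_apply_smul {X Y : ModuleCat.{u} R} (s : L.obj X ⟶ L.obj Y) (r : R) (b : L.obj X) :
    s.hom (r • b) = r • s.hom b :=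
  LinearMap.congr_fun (congrArg ModuleCat.Hom.hom (map_smul_id_comp Z L r s)) b

theorem map_elementHom_eq_zero_iff {X : ModuleCat.{u} R} (x : X) :
    L.map (elementHom x) = 0 ↔ x ∈ torsionRadical Z X := by
  rw [SerreClassLocalization.map_eq_zero_iff L (torsionClass Z), torsionClass_image_iff,
    elementHom, ModuleCat.hom_ofHom, LinearMap.range_toSpanSingleton,
    Submodule.span_singleton_le_iff_mem]

include Z hL in
theorem eq_zero_of_forall_map_elementHom_comp {X : ModuleCat.{u} R} {N : ModuleCat.{u} A}
    (h : L.obj X ⟶ N) (H : ∀ x : X, L.map (elementHom x) ≫ h = 0) : h = 0 := by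
  have := Localization.essSurj L (torsionClass Z).isoModSerre
  obtain ⟨φ, hφ⟩ := Localization.exists_leftFraction L (torsionClass Z).isoModSerre
    (h ≫ (L.objObjPreimageIso N).inv)
  have := Localization.inverts L (torsionClass Z).isoModSerre φ.s φ.hs
  have hφ' : h ≫ (L.objObjPreimageIso N).inv ≫ L.map φ.s = L.map φ.f := by
    rw [← Category.assoc, hφ, MorphismProperty.LeftFraction.map_comp_map_s]
  rw [← cancel_mono ((L.objObjPreimageIso N).inv ≫ L.map φ.s), Limits.zero_comp, hφ',
    SerreClassLocalization.map_eq_zero_iff L (torsionClass Z), torsionClass_image_iff]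
  rintro _ ⟨x, rfl⟩
  rw [← map_elementHom_eq_zero_iff Z L, ← elementHom_comp, L.map_comp, ← hφ', reassoc_of% (H x),
    Limits.zero_comp]

include Z hL in
theorem iSup_range_map_elementHom (X : ModuleCat.{u} R) :
    ⨆ x : X, LinearMap.range (L.map (elementHom x)).hom = ⊤ := by
  set T := ⨆ x : X, LinearMap.range (L.map (elementHom x)).hom
  have hq : ModuleCat.ofHom T.mkQ = 0 :=
    eq_zero_of_forall_map_elementHom_comp Z L _ fun x => ModuleCat.hom_ext <|
      LinearMap.ext fun b => (Submodule.Quotient.mk_eq_zero T).2 <|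
        Submodule.mem_iSup_of_mem x ⟨b, rfl⟩
  rw [← T.ker_mkQ, LinearMap.ker_eq_top]
  exact congrArg ModuleCat.Hom.hom hq

include Z hL in
theorem comparison_surjective (X : ModuleCat.{u} R) : Function.Surjective (comparison L X) := by
  intro b
  rw [← LinearMap.mem_range]
  refine Submodule.iSup_induction _ (motive := (· ∈ LinearMap.range (comparison L X)))
    ((iSup_range_map_elementHom Z L X).ge trivial : b ∈ _) ?_ (zero_mem _)
    fun _ _ => add_mem
  rintro x _ ⟨c, rfl⟩
  exact ⟨x ⊗ₜ c, rfl⟩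

include Z hL in
theorem traceIdeal_fiber : traceIdeal A (Fiber L) = ⊤ := by
  have := Localization.essSurj L (torsionClass Z).isoModSerre
  let α := (L.objObjPreimageIso (ModuleCat.of A A)).toLinearEquiv
  rw [← top_le_iff, ← LinearEquiv.range α, LinearMap.range_eq_map,
    ← iSup_range_map_elementHom Z L, Submodule.map_iSup]
  refine iSup_le fun x => ?_
  rw [← LinearMap.range_comp]
  exact le_iSup (fun f : Module.Dual A (Fiber L) => LinearMap.range f) _

variable {L} in
theorem smul_one_end (r : R) :
    (r • 1 : Module.End A (Fiber L)) = (L.map (elementHom r : ModuleCat.of R R ⟶ _)).hom := by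
  rw [elementHom_eq_smul_id]
  rfl

include Z hL in
theorem smul_end (r : R) (s : Module.End A (Fiber L)) :
    r • s = (L.map (elementHom r : ModuleCat.of R R ⟶ _) ≫ ModuleCat.ofHom s).hom := by
  ext b
  rw [elementHom_eq_smul_id]
  exact (hom_apply_smul Z L (ModuleCat.ofHom s) r b).symm

theorem eq_zero_of_forall_smul_end_eq_zero {I : Ideal R} (hI : I ∈ gabrielTopology Z)
    {s : Module.End A (Fiber L)} (hs : ∀ a ∈ I, a • s = 0) : s = 0 := by
  have := Localization.inverts L _ _ (isoModSerre_subtype hI)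
  suffices ModuleCat.ofHom s = 0 from congrArg ModuleCat.Hom.hom this
  rw [← cancel_epi (L.map (ModuleCat.ofHom I.subtype)), Limits.comp_zero]
  refine eq_zero_of_forall_map_elementHom_comp Z L _ fun a => ?_
  rw [← L.map_comp_assoc, elementHom_comp]
  exact ModuleCat.hom_ext ((smul_end Z L a s).symm.trans (hs a a.2))

theorem exists_smul_end_eq (s : Module.End A (Fiber L)) :
    ∃ I ∈ gabrielTopology Z, ∀ a ∈ I, ∃ r : R, a • s = r • 1 := by
  obtain ⟨φ, hφ⟩ :=
    Localization.exists_rightFraction L (torsionClass Z).isoModSerre (ModuleCat.ofHom s)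
  have := Localization.inverts L (torsionClass Z).isoModSerre φ.s φ.hs
  refine ⟨_, range_mem_gabrielTopology φ.hs, ?_⟩
  rintro _ ⟨x, rfl⟩
  refine ⟨φ.f.hom x, ?_⟩
  rw [smul_end Z, smul_one_end, hφ, ← elementHom_comp, L.map_comp, Category.assoc,
    MorphismProperty.RightFraction.map_s_comp_map, ← L.map_comp, elementHom_comp]

theorem exists_end_extension {I : Ideal R} (hI : I ∈ gabrielTopology Z)
    (f : I →ₗ[R] R ⧸ torsionIdeal Z) : ∃ s : Module.End A (Fiber L),
      ∀ (a : I) (r : R), f a = Submodule.Quotient.mk r → (a : R) • s = r • 1 := by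
  let ι := ModuleCat.ofHom I.subtype
  let π := ModuleCat.ofHom (torsionIdeal Z).mkQ
  have : IsIso (L.map ι) := Localization.inverts L _ _ (isoModSerre_subtype hI)
  have : IsIso (L.map π) := Localization.inverts L _ _ (isoModSerre_mkQ_torsionRadical R)
  refine ⟨(inv (L.map ι) ≫ L.map (ModuleCat.ofHom f) ≫ inv (L.map π)).hom, fun a r har => ?_⟩
  have ha : elementHom (X := .of R R) (a : R) = elementHom (X := .of R I) a ≫ ι :=
    (elementHom_comp (X := .of R I) a ι).symm
  have hr : elementHom (X := .of R I) a ≫ ModuleCat.ofHom f = elementHom (X := .of R R) r ≫ π := by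
    rw [elementHom_comp, elementHom_comp]
    exact congrArg elementHom har
  rw [smul_end Z, smul_one_end, ModuleCat.ofHom_hom, ha, L.map_comp, Category.assoc,
    IsIso.hom_inv_id_assoc, ← L.map_comp_assoc, hr, L.map_comp, Category.assoc,
    IsIso.hom_inv_id, Category.comp_id]

theorem isModuleOfFractions_end : IsModuleOfFractions Z (1 : Module.End A (Fiber L)) where
  smul_eq_zero_iff r := by
    rw [smul_one_end]
    exact ModuleCat.hom_ext_iff.symm.trans (map_elementHom_eq_zero_iff Z L (X := .of R R) r)
  exists_smul_eq := exists_smul_end_eq Z L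
  eq_zero _ hI _ := eq_zero_of_forall_smul_end_eq_zero Z L hI
  exists_extension _ hI := exists_end_extension Z L hI

include Z hL in
theorem smulCommClass_end :
    SMulCommClass R (Module.End A (Fiber L)) (Module.End A (Fiber L)) where
  smul_comm r s t := LinearMap.ext fun b =>
    (hom_apply_smul Z L (ModuleCat.ofHom s) r (t b)).symm

include Z hL in
theorem isMulCommutative_end : IsMulCommutative (Module.End A (Fiber L)) :=
  have := smulCommClass_end Z L
  (isModuleOfFractions_end Z L).isMulCommutative

include Z hL in
theorem finite_and_projective_fiber :
    Module.Finite A (Fiber L) ∧ Module.Projective A (Fiber L) := by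
  have := isMulCommutative_end Z L
  obtain ⟨n, g, c, h⟩ := exists_dualBasis_of_finiteRankEnd_eq_top
    (finiteRankEnd_eq_top_of_traceIdeal_eq_top (traceIdeal_fiber Z L))
  exact ⟨finite_of_dualBasis h, projective_of_dualBasis h⟩

include hL in
theorem smul_top_fiber_eq_top_iff_mem (hZ : StableUnderSpecialization Z) (p : PrimeSpectrum R) :
    p.asIdeal • (⊤ : Submodule R (Fiber L)) = ⊤ ↔ p ∈ Z := by
  have := SerreClassLocalization.preservesFiniteLimits L (torsionClass Z)
  have := SerreClassLocalization.preservesFiniteColimits L (torsionClass Z)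
  rw [smul_top_fiber_eq_top_iff (comparison_surjective Z L),
    SerreClassLocalization.isZero_obj_iff L (torsionClass Z),
    torsionClass_quotient_asIdeal_iff hZ]

include hL in
theorem isPerfect_of_isLocalization (hZ : StableUnderSpecialization Z) : IsPerfect Z := by
  have := SerreClassLocalization.preservesFiniteLimits L (torsionClass Z)
  have := SerreClassLocalization.preservesFiniteColimits L (torsionClass Z)
  have := flat_fiber_of_comparison_surjective (comparison_surjective Z L)
  obtain ⟨_, _⟩ := finite_and_projective_fiber Z L
  have : Module.Flat R (Module.End A (Fiber L)) := flat_end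
  let e := (isModuleOfFractions_end Z L).ringOfFractionsEquiv
  refine ⟨.of_linearEquiv e, Set.ext fun p => ?_⟩
  change p ∈ Z ↔ p.asIdeal.map (algebraMap R (RingOfFractions Z)) = ⊤
  rw [map_algebraMap_eq_top_iff, smul_top_eq_top_iff_of_linearEquiv _ e,
    smul_top_end_eq_top_iff (A := A), smul_top_fiber_eq_top_iff_mem Z L hZ]

end LocalizationFunctor

end SpecLocalization

end

open SpecLocalization in
theorem mainTheorem10_general {R : Type u} [CommRing R]
    (Z : Set (PrimeSpectrum R)) (hZ : StableUnderSpecialization Z) :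
    IsModuleCategory.{u} (QuotientCategory Z) ↔ IsPerfect Z := by
  refine ⟨?_, isModuleCategory_of_isPerfect⟩
  rintro ⟨A, _, ⟨e⟩⟩
  have := additive_of_isEquivalence (torsionClass Z) e.functor
  exact isPerfect_of_isLocalization Z ((torsionClass Z).isoModSerre.Q ⋙ e.functor) hZ

theorem mainTheorem10 {R : Type u} [CommRing R] [IsNoetherianRing R]
    (Z : Set (PrimeSpectrum R)) (hZ : StableUnderSpecialization Z) :
    SpecLocalization.IsModuleCategory.{u} (SpecLocalization.QuotientCategory Z) ↔
      SpecLocalization.IsPerfect Z :=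
  mainTheorem10_general Z hZ
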